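/- Vectors carry the maximum norm $\|\cdot\|_\infty$, matrices the induced norm. Fix $t_0\in\mathbb R$ and agents $i\in\mathcal N=\{1,\dots,N\}$ with identical internal dynamics, $$\dot y_i=F_i(t,y_i,z_i)+\Gamma_i(t,w_i)u_i,\qquad \dot z_i=Z(t,z_i,y_i),\qquad w_i=W_i(y_i,z_i),$$ $y_i,u_i\in\mathbb R^m$, $z_i\in\mathbb R^n$, $w_i\in\mathbb R^{m_i}$, where $F_i$, $Z$, $\Gamma_i$ are defined for $t\ge t_0$, measurable in $t$, locally Lipschitz in the remaining variables and bounded on compact sets of the remaining variables uniformly in $t$; $W_i$ is locally Lipschitz; and all $\Gamma_i(t,w)$ are invertible with $\|\Gamma_i(t,w)^{-1}\|_\infty\le M_\Gamma$ for a constant $M_\Gamma$. Let $\mathcal G$ be an undirected connected graph (without self-loops) on $\mathcal N$ with diameter $d_{\mathcal G}$, let $\mathcal N_i$ be the set of neighbours of $i$, and consider the edge-wise funnel coupling $$u_i=\Gamma_i(t,w_i)^{-1}\sum_{j\in\mathcal N_i}\Big(\mu_{ij}^p\big(\nu_{ij}^p(t)/\psi_{ij}^p(t)\big)\Big)_{p=1}^m,\qquad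 \nu_{ij}=y_j-y_i,$$ where for all edges and all $p$: $\psi_{ij}^p=\psi_{ji}^p:[t_0,\infty)\to(0,\infty)$ is bounded and $C^1$ with bounded derivative; $\mu_{ij}^p:(-1,1)\to\mathbb R$ is continuous, $\mu_{ij}^p(s)\to\pm\infty$ as $s\to\pm1$, and $\mu_{ij}^p(-s)=-\mu_{ji}^p(s)$. Put $\Psi(t)=\max_p\max_{(j,i)}\psi_{ij}^p(t)$, the inner maximum over all edges ($\Psi=0$ if there are no edges or $m=0$). The perturbed blended dynamics, with state $(s,z_1,\dots,z_N)$ and input $(e_1,\dots,e_N)$, is $$\dot s=\tfrac1N\sum_{i=1}^N F_i(t,s+e_i,z_i),\qquad \dot z_i=Z(t,z_i,s+e_i),\quad i\in\mathcal N.$$ Assume that for every initial time $\tau\ge t_0$, all initial values and all locally absolutely continuous inputs $e_i$ with $\|e_i(t)\|_\infty\le d_{\mathcal G}\Psi(t)$ for $t\ge\tau$ it has a global solution (solutions are in the sense of Carathéodory). Assume moreover that the perturbed blended dynamics is $\delta$-ISS with $(\beta,\hat\gamma)$, $\beta\in\mathcal{KL}$, $\hat\gamma\in\mathcal K_\infty$: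 for every initial time $\tau\ge t_0$, all initial values and all locally essentially bounded measurable inputs it has a global solution, and any two solutions $x,\hat x$ on $[\tau,\infty)$ with such inputs $e,\hat e$ satisfy, for all $t\ge\tau$, $$\|\hat x(t)-x(t)\|_\infty\le\beta(\|\hat x(\tau)-x(\tau)\|_\infty,t-\tau)+\hat\gamma\Big(\sup_{s\in[\tau,t)}\|\hat e(s)-e(s)\|_\infty\Big).$$ Then for every decreasing function $w:[0,\infty)\to(0,1]$ with $\lim_{t\to\infty}w(t)=0$ there is $\gamma\in\mathcal K_\infty$ such that the following holds for every $\omega\in(t_0,\infty]$. Let $(y_i,z_i)_{i\in\mathcal N}$ be a solution on $[t_0,\omega)$ of the coupled agents with $|\nu_{ij}^p(t_0)|<\psi_{ij}^p(t_0)$ for all edges and all $p$, and let $(\tilde s,\tilde z)$ be a solution on $[t_0,\omega)$ of the reduced-order blended dynamics $$\dot{\tilde s}=\tfrac1N\sum_{i=1}^N F_i(t,\tilde s,\tilde z),\qquad \dot{\tilde z}=Z(t,\tilde z,\tilde s),\qquad \tilde s(t_0)=\tfrac1N\sum_{i=1}^N y_i(t_0).$$ Then, for all $i\in\mathcal N$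 and all $t\in[t_0,\omega)$, $$\left\|\begin{bmatrix}y_i(t)\\z_i(t)\end{bmatrix}-\begin{bmatrix}\tilde s(t)\\\tilde z(t)\end{bmatrix}\right\|_\infty\le\beta\Big(\max_j\|z_j(t_0)-\tilde z(t_0)\|_\infty,t-t_0\Big)+\gamma\Big(\sup_{s\in[t_0,t)}d_{\mathcal G}\Psi(s)w(t-s)\Big)+d_{\mathcal G}\Psi(t),$$ where suprema over the empty set are $0$. -/

import Mathlib

open Set Filter Topology MeasureTheory

/- Vectors `Fin m → ℝ` and products carry the maximum norm; square matrices carry the operator norm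
induced by the maximum norm. -/
attribute [local instance] Matrix.linftyOpNormedAddCommGroup

/-! ### Carathéodory solutions -/

/-- `x` is a Carathéodory solution of `x' = f (t, x)` on the interval `[τ, ω)`, `ω ≤ ∞`: it is
absolutely continuous on every compact subinterval and satisfies the equation almost everywhere. -/
def IsCaratheodorySolution {E : Type*} [NormedAddCommGroup E] [NormedSpace ℝ E]
    (f : ℝ → E → E) (τ : ℝ) (ω : EReal) (x : ℝ → E) : Prop :=
  (∀ T : ℝ, τ ≤ T → (T : EReal) < ω → AbsolutelyContinuousOnInterval x τ T) ∧
    ∀ᵐ t : ℝ, τ < t → (t : EReal) < ω → HasDerivAt x (f t (x t)) t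

/-! ### Comparison functions and incremental input-to-state stability -/

/-- Class `𝒦` (only the values on `[0, ∞)` matter). -/
structure IsClassK (γ : ℝ → ℝ) : Prop where
  continuousOn : ContinuousOn γ (Ici 0)
  strictMonoOn : StrictMonoOn γ (Ici 0)
  map_zero : γ 0 = 0

/-- Class `𝒦_∞`. -/
structure IsClassKInf (γ : ℝ → ℝ) : Prop extends IsClassK γ where
  unbounded : Tendsto γ atTop atTop

/-- Class `𝒦ℒ`: `β (·, s)` is of class `𝒦` and `β (r, ·)` decreases to `0`. -/
structure IsClassKL (β : ℝ → ℝ → ℝ) : Prop where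
  classK : ∀ s, 0 ≤ s → IsClassK (fun r => β r s)
  antitoneOn : ∀ r, 0 ≤ r → AntitoneOn (β r) (Ici 0)
  tendsto_zero : ∀ r, 0 ≤ r → Tendsto (β r) atTop (𝓝 0)

/-- Locally essentially bounded (Lebesgue) measurable inputs on `[τ, ∞)`. -/
def IsAdmissibleInput {U : Type*} [NormedAddCommGroup U] (τ : ℝ) (u : ℝ → U) : Prop :=
  AEStronglyMeasurable u (volume.restrict (Ici τ)) ∧
    ∀ T : ℝ, ∃ M : ℝ, ∀ᵐ t ∂(volume.restrict (Icc τ T)), ‖u t‖ ≤ M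

/-- The system `x' = f (t, x, u)`, defined for `t ≥ t₀`, is `δ`-ISS with `(β, γ')`: solutions exist
globally for all initial times `τ ≥ t₀`, initial values and admissible inputs, and any two of them
satisfy the incremental estimate. If the supremum of the input difference over `[τ, t)` is infinite,
the right-hand side of the estimate is infinite and nothing is required; the supremum over the empty
interval (`t = τ`) is `0`. -/
structure IsDeltaISS {E U : Type*} [NormedAddCommGroup E] [NormedSpace ℝ E] [NormedAddCommGroup U]
    (t₀ : ℝ) (f : ℝ → E → U → E) (β : ℝ → ℝ → ℝ) (γ' : ℝ → ℝ) : Prop where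
  classKL : IsClassKL β
  classKInf : IsClassKInf γ'
  complete : ∀ τ, t₀ ≤ τ → ∀ (x₀ : E) (u : ℝ → U), IsAdmissibleInput τ u →
    ∃ x : ℝ → E, x τ = x₀ ∧ IsCaratheodorySolution (fun t ξ => f t ξ (u t)) τ ⊤ x
  estimate : ∀ τ, t₀ ≤ τ → ∀ u u' : ℝ → U, IsAdmissibleInput τ u → IsAdmissibleInput τ u' →
    ∀ x x' : ℝ → E,
      IsCaratheodorySolution (fun t ξ => f t ξ (u t)) τ ⊤ x →
      IsCaratheodorySolution (fun t ξ => f t ξ (u' t)) τ ⊤ x' →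
      ∀ t, τ ≤ t → BddAbove ((fun s => ‖u' s - u s‖) '' Ico τ t) →
        ‖x' t - x t‖ ≤ β ‖x' τ - x τ‖ (t - τ) + γ' (sSup ((fun s => ‖u' s - u s‖) '' Ico τ t))

/-! ### Agents with identical internal dynamics -/

/-- The data of `N` agents
`yᵢ' = Fᵢ (t, yᵢ, zᵢ) + Γᵢ (t, wᵢ) uᵢ`, `zᵢ' = Z (t, zᵢ, yᵢ)`, `wᵢ = Wᵢ (yᵢ, zᵢ)`
with outputs `yᵢ ∈ ℝᵐ`, internal states `zᵢ ∈ ℝⁿ` and introspective outputs `wᵢ` of dimension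
`q i`. -/
structure AgentFamily (N m n : ℕ) where
  q : Fin N → ℕ
  F : Fin N → ℝ → (Fin m → ℝ) → (Fin n → ℝ) → (Fin m → ℝ)
  Z : ℝ → (Fin n → ℝ) → (Fin m → ℝ) → (Fin n → ℝ)
  Γ : (i : Fin N) → ℝ → (Fin (q i) → ℝ) → Matrix (Fin m) (Fin m) ℝ
  W : (i : Fin N) → (Fin m → ℝ) → (Fin n → ℝ) → (Fin (q i) → ℝ)

/-- Performance functions `ψ i j p` and coupling functions `μ i j p`. Only the values for neighbours
`i, j` matter. -/
structure EdgeDesign (N m : ℕ) where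
  ψ : Fin N → Fin N → Fin m → ℝ → ℝ
  μ : Fin N → Fin N → Fin m → ℝ → ℝ

namespace AgentFamily

variable {N m n : ℕ}

/-- Regularity of the open-loop dynamics: measurable in `t`, locally Lipschitz in the state, bounded
on compact sets uniformly in `t ≥ t₀`. -/
structure OpenLoopAssumption (A : AgentFamily N m n) (t₀ : ℝ) : Prop where
  F_meas : ∀ i y z, AEMeasurable (fun t => A.F i t y z) (volume.restrict (Ici t₀))
  F_lip : ∀ i t, t₀ ≤ t →
    LocallyLipschitz (fun x : (Fin m → ℝ) × (Fin n → ℝ) => A.F i t x.1 x.2)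
  F_bdd : ∀ i, ∀ K : Set ((Fin m → ℝ) × (Fin n → ℝ)), IsCompact K →
    ∃ M : ℝ, ∀ t, t₀ ≤ t → ∀ x ∈ K, ‖A.F i t x.1 x.2‖ ≤ M
  Z_meas : ∀ z y, AEMeasurable (fun t => A.Z t z y) (volume.restrict (Ici t₀))
  Z_lip : ∀ t, t₀ ≤ t →
    LocallyLipschitz (fun x : (Fin n → ℝ) × (Fin m → ℝ) => A.Z t x.1 x.2)
  Z_bdd : ∀ K : Set ((Fin n → ℝ) × (Fin m → ℝ)), IsCompact K →
    ∃ M : ℝ, ∀ t, t₀ ≤ t → ∀ x ∈ K, ‖A.Z t x.1 x.2‖ ≤ M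
  Γ_meas : ∀ i w a b, AEMeasurable (fun t => A.Γ i t w a b) (volume.restrict (Ici t₀))
  Γ_lip : ∀ i t, t₀ ≤ t → LocallyLipschitz (fun w => A.Γ i t w)
  Γ_bdd : ∀ i, ∀ K : Set (Fin (A.q i) → ℝ), IsCompact K →
    ∃ M : ℝ, ∀ t, t₀ ≤ t → ∀ w ∈ K, ‖A.Γ i t w‖ ≤ M
  W_lip : ∀ i, LocallyLipschitz (fun x : (Fin m → ℝ) × (Fin n → ℝ) => A.W i x.1 x.2)

/-- The gain matrices are invertible with uniformly bounded inverse. -/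
structure GainAssumption (A : AgentFamily N m n) (t₀ : ℝ) : Prop where
  isUnit : ∀ i t, t₀ ≤ t → ∀ w, IsUnit (A.Γ i t w)
  inv_bdd : ∃ M : ℝ, 0 < M ∧ ∀ i t, t₀ ≤ t → ∀ w, ‖(A.Γ i t w)⁻¹‖ ≤ M

/-- The edge-wise funnel coupling law
`uᵢ = Γᵢ (t, wᵢ)⁻¹ ∑_{j ∈ 𝒩ᵢ} (μ_ij^p ((y_j^p - y_i^p) / ψ_ij^p (t)))_p`. -/
noncomputable def funnelCoupling (A : AgentFamily N m n) (G : SimpleGraph (Fin N))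
    [DecidableRel G.Adj] (C : EdgeDesign N m) (t : ℝ) (y : Fin N → Fin m → ℝ) (i : Fin N)
    (w : Fin (A.q i) → ℝ) : Fin m → ℝ :=
  (A.Γ i t w)⁻¹.mulVec
    (∑ j ∈ G.neighborFinset i, fun p => C.μ i j p ((y j p - y i p) / C.ψ i j p t))

/-- The right-hand side of the closed loop of the agents and the coupling law; the state is
`(y, z)`. -/
noncomputable def closedLoop (A : AgentFamily N m n) (G : SimpleGraph (Fin N))
    [DecidableRel G.Adj] (C : EdgeDesign N m) (t : ℝ)
    (x : (Fin N → Fin m → ℝ) × (Fin N → Fin n → ℝ)) :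
    (Fin N → Fin m → ℝ) × (Fin N → Fin n → ℝ) :=
  (fun i => A.F i t (x.1 i) (x.2 i) +
      (A.Γ i t (A.W i (x.1 i) (x.2 i))).mulVec
        (A.funnelCoupling G C t x.1 i (A.W i (x.1 i) (x.2 i))),
   fun i => A.Z t (x.2 i) (x.1 i))

/-- The right-hand side of the perturbed blended dynamics with state `(s, z₁, …, z_N)` and input
`(e₁, …, e_N)`. -/
noncomputable def perturbedBlended (A : AgentFamily N m n) (t : ℝ)
    (x : (Fin m → ℝ) × (Fin N → Fin n → ℝ)) (e : Fin N → Fin m → ℝ) :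
    (Fin m → ℝ) × (Fin N → Fin n → ℝ) :=
  ((N : ℝ)⁻¹ • ∑ i, A.F i t (x.1 + e i) (x.2 i), fun i => A.Z t (x.2 i) (x.1 + e i))

/-- The right-hand side of the reduced-order blended dynamics with state `(s, z)`. -/
noncomputable def reducedBlended (A : AgentFamily N m n) (t : ℝ)
    (x : (Fin m → ℝ) × (Fin n → ℝ)) : (Fin m → ℝ) × (Fin n → ℝ) :=
  ((N : ℝ)⁻¹ • ∑ i, A.F i t x.1 x.2, A.Z t x.2 x.1)

end AgentFamily

namespace EdgeDesign

variable {N m : ℕ}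

/-- The requirements on the performance and coupling functions on the edges of `G`. The coupling
functions are constrained on `(-1, 1)` only; their values elsewhere are arbitrary. -/
structure Admissible (C : EdgeDesign N m) (G : SimpleGraph (Fin N)) (t₀ : ℝ) : Prop where
  ψ_pos : ∀ i j, G.Adj i j → ∀ p t, t₀ ≤ t → 0 < C.ψ i j p t
  ψ_contDiff : ∀ i j, G.Adj i j → ∀ p, ContDiffOn ℝ 1 (C.ψ i j p) (Ici t₀)
  ψ_bdd : ∀ i j, G.Adj i j → ∀ p, ∃ M : ℝ, ∀ t, t₀ ≤ t → |C.ψ i j p t| ≤ M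
  ψ_deriv_bdd : ∀ i j, G.Adj i j → ∀ p, ∃ M : ℝ, ∀ t, t₀ ≤ t →
    |derivWithin (C.ψ i j p) (Ici t₀) t| ≤ M
  ψ_symm : ∀ i j, G.Adj i j → ∀ p t, t₀ ≤ t → C.ψ i j p t = C.ψ j i p t
  μ_cont : ∀ i j, G.Adj i j → ∀ p, ContinuousOn (C.μ i j p) (Ioo (-1) 1)
  μ_top : ∀ i j, G.Adj i j → ∀ p, Tendsto (C.μ i j p) (𝓝[<] 1) atTop
  μ_bot : ∀ i j, G.Adj i j → ∀ p, Tendsto (C.μ i j p) (𝓝[>] (-1)) atBot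
  μ_symm : ∀ i j, G.Adj i j → ∀ p, ∀ s ∈ Ioo (-1 : ℝ) 1, C.μ i j p (-s) = -C.μ j i p s

/-- `Ψ (t)`, the maximum of the performance functions over all edges and components (`0` if there
are none). -/
noncomputable def maxWidth (C : EdgeDesign N m) (G : SimpleGraph (Fin N)) (t : ℝ) : ℝ :=
  sSup {r | ∃ i j p, G.Adj i j ∧ r = C.ψ i j p t}

/-- All output differences over the edges lie inside their funnels at time `t`. -/
def InFunnel (C : EdgeDesign N m) (G : SimpleGraph (Fin N)) (t : ℝ)
    (y : Fin N → Fin m → ℝ) : Prop :=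
  ∀ i j, G.Adj i j → ∀ p, |y j p - y i p| < C.ψ i j p t

end EdgeDesign

/-- No finite escape time: for all initial times `τ ≥ t₀` and initial values, the perturbed blended
dynamics has a global solution for every (locally) absolutely continuous input `e` with
`‖eᵢ (t)‖ ≤ d_G Ψ (t)` for all `i` and `t ≥ τ`. -/
def NoFiniteEscape {N m n : ℕ} (A : AgentFamily N m n) (G : SimpleGraph (Fin N))
    (C : EdgeDesign N m) (t₀ : ℝ) : Prop :=
  ∀ τ, t₀ ≤ τ → ∀ e : ℝ → Fin N → Fin m → ℝ,
    (∀ T, τ ≤ T → AbsolutelyContinuousOnInterval e τ T) →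
    (∀ t, τ ≤ t → ∀ i, ‖e t i‖ ≤ G.diam * C.maxWidth G t) →
    ∀ x₀ : (Fin m → ℝ) × (Fin N → Fin n → ℝ), ∃ x : ℝ → (Fin m → ℝ) × (Fin N → Fin n → ℝ),
      x τ = x₀ ∧ IsCaratheodorySolution (fun t ξ => A.perturbedBlended t ξ (e t)) τ ⊤ x

/-! Three facts combine: the funnels are never left, the coupling disappears from the mean, and
δ-ISS can be made to forget past inputs at the rate `w`.

Funnel invariance (`not_saturated`). At a first exit time τ, orient every saturated edge of one
component p from the larger output to the smaller. The values y_i^p(τ) strictly decrease along these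
edges, so the edges carry a nonnegative flow c whose net outflow x also decreases along them
(`exists_flow_outflow_decreasing`). The weighted gap V = ∑ c_e (ψ_e - (y_{e.1} - y_{e.2})) is
nonnegative before τ and zero at τ. In its derivative the outputs have weights -x_i, and summation
by parts gives each coupling force the factor x_k - x_i. On saturated edges this factor has the sign
of the diverging force, and all other forces stay bounded. Hence V' → ∞ as t ↑ τ, which is
impossible.

Mean. Inside the funnels the forces are antisymmetric and cancel in the sum. The mean with all z_i
therefore solves the perturbed blended dynamics with e_i = y_i - mean, and a shortest path gives
‖e_i‖ ≤ d_G Ψ. The reduced dynamics, with z copied to all agents, is the case e = 0.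

Fading gain (`exists_fading_gain`). For equal initial values, restarting the δ-ISS estimate at t - a
bounds the difference by β(γ'(M), a) + γ'(r / w(a)), where r is the discounted supremum. A large a,
followed by a small r, makes this small, so a 𝒦_∞ function of r dominates it.

An unperturbed solution started at the mean is the intermediate trajectory: one side yields the β
term, the other the γ term, and ‖e_i(t)‖ the last. -/

/-! ### Absolutely continuous functions -/

namespace AbsolutelyContinuousOnInterval

theorem comp_lipschitzWith {X Y : Type*} [PseudoMetricSpace X] [PseudoMetricSpace Y] {f : ℝ → X}
    {a b : ℝ} (hf : AbsolutelyContinuousOnInterval f a b) {K : NNReal} {φ : X → Y}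
    (hφ : LipschitzWith K φ) : AbsolutelyContinuousOnInterval (fun t => φ (f t)) a b := by
  have h := Tendsto.const_mul (K : ℝ) hf
  rw [mul_zero] at h
  refine squeeze_zero (fun E => Finset.sum_nonneg fun i _ => dist_nonneg) (fun E => ?_) h
  rw [Finset.mul_sum]
  exact Finset.sum_le_sum fun i _ => hφ.dist_le_mul _ _

theorem apply {ι X : Type*} [Fintype ι] [PseudoMetricSpace X] {f : ℝ → ι → X} {a b : ℝ}
    (hf : AbsolutelyContinuousOnInterval f a b) (i : ι) :
    AbsolutelyContinuousOnInterval (fun t => f t i) a b :=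
  hf.comp_lipschitzWith (φ := fun x : ι → X => x i) (LipschitzWith.eval i)

theorem fst {X Y : Type*} [PseudoMetricSpace X] [PseudoMetricSpace Y] {f : ℝ → X} {g : ℝ → Y}
    {a b : ℝ} (hf : AbsolutelyContinuousOnInterval (fun t => (f t, g t)) a b) :
    AbsolutelyContinuousOnInterval f a b :=
  hf.comp_lipschitzWith (φ := Prod.fst) LipschitzWith.prod_fst

theorem congr {X : Type*} [PseudoMetricSpace X] {f g : ℝ → X} {a b : ℝ}
    (hf : AbsolutelyContinuousOnInterval f a b) (h : EqOn f g (uIcc a b)) :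
    AbsolutelyContinuousOnInterval g a b := by
  rw [absolutelyContinuousOnInterval_iff] at hf ⊢
  intro ε hε
  obtain ⟨δ, hδ, H⟩ := hf ε hε
  refine ⟨δ, hδ, fun E hE hl => ?_⟩
  refine lt_of_eq_of_lt (Finset.sum_congr rfl fun i hi => ?_) (H E hE hl)
  rw [h (hE.1 i hi).1, h (hE.1 i hi).2]

/-- The second hypothesis on φ keeps total lengths small and the third keeps disjoint intervals
disjoint. The intended φ are the truncations at a point. -/
theorem comp_contraction {X : Type*} [PseudoMetricSpace X] {f : ℝ → X} {a b c d : ℝ}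
    (hf : AbsolutelyContinuousOnInterval f a b) {φ : ℝ → ℝ}
    (hmaps : MapsTo φ (uIcc c d) (uIcc a b)) (hdist : ∀ x y, dist (φ x) (φ y) ≤ dist x y)
    (hsub : ∀ x y, uIoc (φ x) (φ y) ⊆ uIoc x y) :
    AbsolutelyContinuousOnInterval (fun t => f (φ t)) c d := by
  rw [absolutelyContinuousOnInterval_iff] at hf ⊢
  intro ε hε
  obtain ⟨δ, hδ, H⟩ := hf ε hε
  refine ⟨δ, hδ, fun E hE hl => ?_⟩
  refine H (E.1, fun i => (φ (E.2 i).1, φ (E.2 i).2)) ⟨fun i hi => ?_, fun i hi j hj hij => ?_⟩ ?_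
  · exact ⟨hmaps (hE.1 i hi).1, hmaps (hE.1 i hi).2⟩
  · exact (hE.2 hi hj hij).mono (hsub _ _) (hsub _ _)
  · exact lt_of_le_of_lt (Finset.sum_le_sum fun i _ => hdist _ _) hl

theorem trans {F : Type*} [NormedAddCommGroup F] [NormedSpace ℝ F] {f : ℝ → F} {a b c : ℝ}
    (hab : a ≤ b) (hbc : b ≤ c) (h₁ : AbsolutelyContinuousOnInterval f a b)
    (h₂ : AbsolutelyContinuousOnInterval f b c) : AbsolutelyContinuousOnInterval f a c := by
  have H₁ : AbsolutelyContinuousOnInterval (fun t => f (min t b)) a c := by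
    refine h₁.comp_contraction (fun t ht => ?_) (fun x y => ?_) (fun x y => ?_)
    · rw [uIcc_of_le (hab.trans hbc)] at ht
      rw [uIcc_of_le hab]
      exact ⟨le_min ht.1 hab, min_le_right _ _⟩
    · simpa [Real.dist_eq] using abs_min_sub_min_le_max x b y b
    · intro t ht
      simp only [mem_uIoc] at ht ⊢
      grind
  have H₂ : AbsolutelyContinuousOnInterval (fun t => f (max t b)) a c := by
    refine h₂.comp_contraction (fun t ht => ?_) (fun x y => ?_) (fun x y => ?_)
    · rw [uIcc_of_le (hab.trans hbc)] at ht
      rw [uIcc_of_le hbc]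
      exact ⟨le_max_right _ _, max_le ht.2 hbc⟩
    · simpa [Real.dist_eq] using abs_max_sub_max_le_max x b y b
    · intro t ht
      simp only [mem_uIoc] at ht ⊢
      grind
  have H₃ : AbsolutelyContinuousOnInterval (fun _ : ℝ => f b) a c :=
    (LipschitzWith.const (f b)).lipschitzOnWith.absolutelyContinuousOnInterval
  -- Gluing identity: f(t) = f(min t b) + f(max t b) - f(b).
  refine ((H₁.add H₂).sub H₃).congr fun t _ => ?_
  rcases le_total t b with h | h <;> simp [h]

theorem le_of_ae_hasDerivAt_nonneg {f f' : ℝ → ℝ} {a b : ℝ} (hab : a ≤ b)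
    (hf : AbsolutelyContinuousOnInterval f a b)
    (h : ∀ᵐ t : ℝ, t ∈ Ioo a b → HasDerivAt f (f' t) t ∧ 0 ≤ f' t) : f a ≤ f b := by
  rw [← sub_nonneg, ← hf.integral_deriv_eq_sub]
  refine intervalIntegral.integral_nonneg_of_ae_restrict hab ?_
  rw [← restrict_Ioo_eq_restrict_Icc]
  rw [EventuallyLE, ae_restrict_iff' measurableSet_Ioo]
  filter_upwards [h] with t ht hmem
  rw [(ht hmem).1.deriv]
  exact (ht hmem).2

theorem finset_sum {F ι : Type*} [NormedAddCommGroup F] {f : ι → ℝ → F} {a b : ℝ} (s : Finset ι)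
    (h : ∀ i ∈ s, AbsolutelyContinuousOnInterval (f i) a b) :
    AbsolutelyContinuousOnInterval (fun t => ∑ i ∈ s, f i t) a b := by
  classical
  induction s using Finset.induction_on with
  | empty =>
    simpa using (LipschitzWith.const (0 : F)).lipschitzOnWith.absolutelyContinuousOnInterval
  | insert i s his ih =>
    simp only [Finset.sum_insert his]
    exact (h i (by simp)).fun_add (ih fun j hj => h j (by simp [hj]))

end AbsolutelyContinuousOnInterval

/-! ### Flows on acyclic graphs -/

/-- A potential `h` which decreases along the edges in `S` can be replaced by one which is the net
outflow `x` of a nonnegative flow `c` on `S`. -/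
theorem exists_flow_outflow_decreasing {V : Type*} [Fintype V] (S : Finset (V × V))
    (hS : S.Nonempty) (h : V → ℝ) (hh : ∀ e ∈ S, h e.2 < h e.1) :
    ∃ (c : V × V → ℝ) (x : V → ℝ), (∀ e ∈ S, 0 ≤ c e) ∧
      (∀ v : V → ℝ, ∑ i, x i * v i = ∑ e ∈ S, c e * (v e.1 - v e.2)) ∧ ∀ e ∈ S, x e.2 < x e.1 := by
  classical
  let b : V × V → EuclideanSpace ℝ V :=
    fun e => EuclideanSpace.single e.1 1 - EuclideanSpace.single e.2 1
  have hb : ∀ (v : EuclideanSpace ℝ V) e, inner ℝ v (b e) = v e.1 - v e.2 := fun v e => by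
    simp [b, inner_sub_right, EuclideanSpace.inner_single_right]
  let K := convexHull ℝ (b '' S)
  have hne : K.Nonempty := ((Finset.coe_nonempty.2 hS).image b).convexHull
  have hK : IsCompact K := (S.finite_toSet.image b).isCompact_convexHull (𝕜 := ℝ)
  -- x is the point of least norm in the hull of the edge vectors δ_{e.1} - δ_{e.2}. It is nonzero
  -- because h is positive on the hull.
  obtain ⟨x, hxK, hx⟩ :=
    exists_norm_eq_iInf_of_complete_convex hne hK.isComplete (convex_convexHull ℝ _) 0
  rw [norm_eq_iInf_iff_real_inner_le_zero (convex_convexHull ℝ _) hxK] at hx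
  have hpos : K ⊆ {w | 0 < inner ℝ (WithLp.toLp 2 h : EuclideanSpace ℝ V) w} := by
    refine convexHull_min ?_ (convex_halfSpace_gt
      (innerSL ℝ (WithLp.toLp 2 h : EuclideanSpace ℝ V)).toLinearMap.isLinear 0)
    rintro _ ⟨e, he, rfl⟩
    simpa [hb] using hh e he
  have hx0 : x ≠ 0 := by
    rintro rfl
    simpa using hpos hxK
  have hcone : K ⊆ {w | ∃ c : V × V → ℝ, (∀ e ∈ S, 0 ≤ c e) ∧ w = ∑ e ∈ S, c e • b e} := by
    refine convexHull_min ?_ ?_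
    · rintro _ ⟨e, he, rfl⟩
      refine ⟨Pi.single e 1, fun e' _ => ?_, ?_⟩
      · by_cases h : e' = e <;> simp [h]
      · rw [Finset.sum_eq_single_of_mem e he fun e' _ hne => by simp [hne]]
        simp
    · rintro _ ⟨c₁, h₁, rfl⟩ _ ⟨c₂, h₂, rfl⟩ r s hr hs -
      refine ⟨fun e => r * c₁ e + s * c₂ e, fun e he => ?_, ?_⟩
      · have := h₁ e he
        have := h₂ e he
        positivity
      · simp only [Finset.smul_sum, ← Finset.sum_add_distrib, add_smul, mul_smul]
  obtain ⟨c, hc, hxc⟩ := hcone hxK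
  refine ⟨c, x, hc, fun v => ?_, fun e he => ?_⟩
  · have : ∑ i, x i * v i = inner ℝ (WithLp.toLp 2 v : EuclideanSpace ℝ V) x := by
      simp [PiLp.inner_apply]
    rw [this, hxc, inner_sum]
    simp [inner_smul_right, hb]
  -- The variational inequality of the projection, tested at an edge vector, gives x e.1 - x e.2 ≥
  -- ‖x‖² > 0.
  · have h1 := hx (b e) (subset_convexHull ℝ _ ⟨e, he, rfl⟩)
    rw [zero_sub, inner_neg_left, inner_sub_right, hb, real_inner_self_eq_norm_sq] at h1
    have h2 : 0 < ‖x‖ ^ 2 := by positivity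
    linarith

/-- Summation by parts for an antisymmetric flow. -/
theorem sum_mul_sum_of_antisymm {V : Type*} [Fintype V] (x : V → ℝ) (φ : V → V → ℝ)
    (h : ∀ i k, φ i k = -φ k i) :
    ∑ i, x i * ∑ k, φ i k = 2⁻¹ * ∑ i, ∑ k, (x i - x k) * φ i k := by
  have h1 : ∑ i, ∑ k, x k * φ i k = -∑ i, x i * ∑ k, φ i k := by
    rw [Finset.sum_comm, ← Finset.sum_neg_distrib]
    refine Finset.sum_congr rfl fun i _ => ?_
    rw [Finset.mul_sum, ← Finset.sum_neg_distrib]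
    exact Finset.sum_congr rfl fun k _ => by rw [h k i]; ring
  simp only [sub_mul, Finset.sum_sub_distrib, h1, ← Finset.mul_sum]
  ring

/-- A finite sum of functions bounded below, one of which tends to infinity. -/
theorem tendsto_atTop_finset_sum {α ι : Type*} {l : Filter α} (s : Finset ι) (f : ι → α → ℝ)
    (hb : ∀ i ∈ s, ∃ M, ∀ᶠ t in l, M ≤ f i t) {i₀ : ι} (hi₀ : i₀ ∈ s)
    (h : Tendsto (f i₀) l atTop) : Tendsto (fun t => ∑ i ∈ s, f i t) l atTop := by
  classical
  choose! M hM using hb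
  have h1 : ∀ᶠ t in l, ∀ i ∈ s.erase i₀, M i ≤ f i t :=
    (Finset.eventually_all _).2 fun i hi => hM i (Finset.mem_of_mem_erase hi)
  refine tendsto_atTop_mono' l ?_ (tendsto_atTop_add_const_right l (∑ i ∈ s.erase i₀, M i) h)
  filter_upwards [h1] with t ht
  rw [← Finset.add_sum_erase s (fun i => f i t) hi₀]
  gcongr with i hi
  exact ht i hi

/-! ### The coupling forces -/

/-- The `p`-th component of the force exerted on agent `i` by agent `k`; zero if they are not
neighbours. -/
noncomputable def EdgeDesign.force {N m : ℕ} (C : EdgeDesign N m) (G : SimpleGraph (Fin N))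
    [DecidableRel G.Adj] (p : Fin m) (t : ℝ) (y : Fin N → Fin m → ℝ) (i k : Fin N) : ℝ :=
  if G.Adj i k then C.μ i k p ((y k p - y i p) / C.ψ i k p t) else 0

namespace EdgeDesign

variable {N m : ℕ} {C : EdgeDesign N m} {G : SimpleGraph (Fin N)} {t₀ : ℝ}

theorem InFunnel.div_mem_Ioo {t : ℝ} {y : Fin N → Fin m → ℝ} (h : C.InFunnel G t y) {i k : Fin N}
    (hik : G.Adj i k) (p : Fin m) : (y k p - y i p) / C.ψ i k p t ∈ Ioo (-1 : ℝ) 1 := by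
  have h1 := h i k hik p
  have h2 : 0 < C.ψ i k p t := (abs_nonneg _).trans_lt h1
  rw [mem_Ioo, ← abs_lt, abs_div, abs_of_pos h2, div_lt_one h2]
  exact h1

/-- The funnel hypothesis is needed because the symmetry of μ is only known on (-1, 1). -/
theorem force_antisymm [DecidableRel G.Adj] (hC : C.Admissible G t₀) (p : Fin m) {t : ℝ}
    (ht : t₀ ≤ t) {y : Fin N → Fin m → ℝ} (h : C.InFunnel G t y) (i k : Fin N) :
    C.force G p t y i k = -C.force G p t y k i := by
  unfold force
  by_cases hik : G.Adj i k
  · rw [if_pos hik, if_pos hik.symm, ← hC.μ_symm i k hik p _ (h.div_mem_Ioo hik.symm p),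
      hC.ψ_symm i k hik p t ht]
    congr 1
    ring
  · rw [if_neg hik, if_neg fun h => hik h.symm, neg_zero]

end EdgeDesign

namespace AgentFamily

variable {N m n : ℕ} {A : AgentFamily N m n} {G : SimpleGraph (Fin N)} [DecidableRel G.Adj]
  {C : EdgeDesign N m} {t₀ : ℝ}

theorem closedLoop_fst_apply (hΓ : A.GainAssumption t₀) {t : ℝ} (ht : t₀ ≤ t)
    (x : (Fin N → Fin m → ℝ) × (Fin N → Fin n → ℝ)) (i : Fin N) (p : Fin m) :
    (A.closedLoop G C t x).1 i p = A.F i t (x.1 i) (x.2 i) p + ∑ k, C.force G p t x.1 i k := by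
  have hu := (Matrix.isUnit_iff_isUnit_det _).1 (hΓ.isUnit i t ht (A.W i (x.1 i) (x.2 i)))
  simp only [closedLoop, funnelCoupling, Matrix.mulVec_mulVec, Matrix.mul_nonsing_inv _ hu,
    Matrix.one_mulVec, Pi.add_apply, Finset.sum_apply, EdgeDesign.force]
  rw [← Finset.sum_filter]
  congr 1
  refine Finset.sum_congr ?_ fun _ _ => rfl
  ext k
  simp

/-- On an edge which is saturated at time `τ` the coupling force diverges, in the direction which
pulls the agents together; on the other edges it stays bounded. -/
theorem force_eventually (hC : C.Admissible G t₀) {τ : ℝ} (hτ : t₀ < τ)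
    {y : ℝ → Fin N → Fin m → ℝ} (hy : ContinuousOn y (Icc t₀ τ))
    (hfun : ∀ t ∈ Ico t₀ τ, C.InFunnel G t (y t)) (p : Fin m) {i k : Fin N} (hik : G.Adj i k) :
    (y τ k p - y τ i p = -C.ψ i k p τ ∧
        Tendsto (fun t => C.force G p t (y t) i k) (𝓝[<] τ) atBot) ∨
      (y τ k p - y τ i p = C.ψ i k p τ ∧
        Tendsto (fun t => C.force G p t (y t) i k) (𝓝[<] τ) atTop) ∨
      (|y τ k p - y τ i p| < C.ψ i k p τ ∧
        ∃ a, Tendsto (fun t => C.force G p t (y t) i k) (𝓝[<] τ) (𝓝 a)) := by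
  have hψ := hC.ψ_pos i k hik p
  have hle : 𝓝[<] τ ≤ 𝓝[Icc t₀ τ] τ := by
    rw [← nhdsWithin_Ico_eq_nhdsLT hτ]
    exact nhdsWithin_mono _ Ico_subset_Icc_self
  have hψc : ContinuousOn (C.ψ i k p) (Icc t₀ τ) :=
    (hC.ψ_contDiff i k hik p).continuousOn.mono Icc_subset_Ici_self
  have hcomp : ∀ j, ContinuousOn (fun t => y t j p) (Icc t₀ τ) := fun j =>
    (continuous_apply_apply j p).comp_continuousOn hy
  have hq : ContinuousOn (fun t => (y t k p - y t i p) / C.ψ i k p t) (Icc t₀ τ) :=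
    ((hcomp k).sub (hcomp i)).div hψc fun t ht => (hψ t ht.1).ne'
  have hlim : Tendsto (fun t => (y t k p - y t i p) / C.ψ i k p t) (𝓝[<] τ)
      (𝓝 ((y τ k p - y τ i p) / C.ψ i k p τ)) :=
    (hq τ (right_mem_Icc.2 hτ.le)).tendsto.mono_left hle
  have hmem : ∀ᶠ t in 𝓝[<] τ, (y t k p - y t i p) / C.ψ i k p t ∈ Ioo (-1 : ℝ) 1 := by
    filter_upwards [Ico_mem_nhdsLT hτ] with t ht
    exact (hfun t ht).div_mem_Ioo hik p
  have hcl : (y τ k p - y τ i p) / C.ψ i k p τ ∈ Icc (-1 : ℝ) 1 :=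
    isClosed_Icc.mem_of_tendsto hlim (hmem.mono fun _ h => Ioo_subset_Icc_self h)
  have hψτ := hψ τ hτ.le
  have hforce : (fun t => C.force G p t (y t) i k) =
      fun t => C.μ i k p ((y t k p - y t i p) / C.ψ i k p t) := by
    funext t
    simp [EdgeDesign.force, hik]
  rw [hforce]
  rcases hcl.1.eq_or_lt with h | h
  · left
    refine ⟨by rw [eq_div_iff hψτ.ne'] at h; linarith, (hC.μ_bot i k hik p).comp ?_⟩
    exact tendsto_nhdsWithin_iff.2 ⟨h ▸ hlim, hmem.mono fun _ h => h.1⟩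
  right
  rcases hcl.2.eq_or_lt with h' | h'
  · left
    refine ⟨by rw [div_eq_iff hψτ.ne'] at h'; linarith, (hC.μ_top i k hik p).comp ?_⟩
    exact tendsto_nhdsWithin_iff.2 ⟨h' ▸ hlim, hmem.mono fun _ h => h.2⟩
  right
  refine ⟨?_, _, ((hC.μ_cont i k hik p).continuousAt (Ioo_mem_nhds h h')).tendsto.comp hlim⟩
  rw [← div_lt_one hψτ, ← abs_of_pos hψτ, ← abs_div]
  exact abs_lt.2 ⟨h, h'⟩

/-- A solution of the closed loop which lies inside the funnels up to time `τ` does not reach the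
boundary of a funnel at time `τ`. -/
theorem not_saturated (hA : A.OpenLoopAssumption t₀) (hΓ : A.GainAssumption t₀)
    (hC : C.Admissible G t₀) {τ : ℝ} (hτ : t₀ < τ)
    {y : ℝ → Fin N → Fin m → ℝ} {z : ℝ → Fin N → Fin n → ℝ}
    (hac : AbsolutelyContinuousOnInterval (fun t => (y t, z t)) t₀ τ)
    (hode : ∀ᵐ t : ℝ, t ∈ Ioo t₀ τ →
      HasDerivAt (fun t => (y t, z t)) (A.closedLoop G C t (y t, z t)) t)
    (hfun : ∀ t ∈ Ico t₀ τ, C.InFunnel G t (y t)) {i₀ k₀ : Fin N} (hadj : G.Adj i₀ k₀) {p : Fin m}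
    (hsat : y τ i₀ p - y τ k₀ p = C.ψ i₀ k₀ p τ) : False := by
  classical
  have hyz : ContinuousOn (fun t => (y t, z t)) (Icc t₀ τ) := by
    simpa [uIcc_of_le hτ.le] using hac.continuousOn
  have hy : ContinuousOn y (Icc t₀ τ) := continuous_fst.comp_continuousOn hyz
  let S : Finset (Fin N × Fin N) := Finset.univ.filter fun e =>
    G.Adj e.1 e.2 ∧ y τ e.1 p - y τ e.2 p = C.ψ e.1 e.2 p τ
  have hmemS : ∀ e, e ∈ S ↔ G.Adj e.1 e.2 ∧ y τ e.1 p - y τ e.2 p = C.ψ e.1 e.2 p τ := by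
    simp [S]
  obtain ⟨c, x, hc, hcx, hx⟩ := exists_flow_outflow_decreasing S ⟨(i₀, k₀), by simp [S, hadj, hsat]⟩
    (fun i => y τ i p) fun e he => by
      have h1 := (hmemS e).1 he
      have := hC.ψ_pos e.1 e.2 h1.1 p τ hτ.le
      linarith
  -- the weighted gap
  let V : ℝ → ℝ := fun t => ∑ e ∈ S, c e * C.ψ e.1 e.2 p t - ∑ i, x i * y t i p
  -- The outflow identity links two forms of V: this one shows its sign inside the funnels, the
  -- defining one shows the weights x on the outputs.
  have hV : ∀ t, V t = ∑ e ∈ S, c e * (C.ψ e.1 e.2 p t - (y t e.1 p - y t e.2 p)) := fun t => by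
    simp only [V, hcx fun i => y t i p, ← Finset.sum_sub_distrib, mul_sub]
  have hVτ : V τ = 0 := by
    rw [hV]
    exact Finset.sum_eq_zero fun e he => by rw [((hmemS e).1 he).2]; ring
  have hVnn : ∀ t ∈ Ico t₀ τ, 0 ≤ V t := fun t ht => by
    rw [hV]
    refine Finset.sum_nonneg fun e he => mul_nonneg (hc e he) ?_
    have := (abs_lt.1 (hfun t ht e.1 e.2 ((hmemS e).1 he).1 p)).1
    linarith
  let V' : ℝ → ℝ := fun t => ∑ e ∈ S, c e * deriv (C.ψ e.1 e.2 p) t -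
    ∑ i, x i * (A.F i t (y t i) (z t i) p + ∑ k, C.force G p t (y t) i k)
  have hVac : AbsolutelyContinuousOnInterval V t₀ τ := by
    refine .fun_sub (.finset_sum _ fun e he => .const_mul _ ?_)
      (.finset_sum _ fun i _ => .const_mul _ ?_)
    · refine ((hC.ψ_contDiff e.1 e.2 ((hmemS e).1 he).1 p).mono ?_).absolutelyContinuousOnInterval
      rw [uIcc_of_le hτ.le]
      exact Icc_subset_Ici_self
    · exact (hac.fst.apply i).apply p
  have hψderiv : ∀ e ∈ S, ∀ t ∈ Ioo t₀ τ,
      HasDerivAt (C.ψ e.1 e.2 p) (deriv (C.ψ e.1 e.2 p) t) t := fun e he t ht =>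
    (((hC.ψ_contDiff e.1 e.2 ((hmemS e).1 he).1 p).differentiableOn (by simp)).differentiableAt
      (Ici_mem_nhds ht.1)).hasDerivAt
  have hVderiv : ∀ᵐ t : ℝ, t ∈ Ioo t₀ τ → HasDerivAt V (V' t) t := by
    filter_upwards [hode] with t ht hmem
    have h1 : ∀ i, HasDerivAt (fun t => y t i p)
        (A.F i t (y t i) (z t i) p + ∑ k, C.force G p t (y t) i k) t := fun i => by
      rw [← closedLoop_fst_apply hΓ hmem.1.le (y t, z t) i p]
      exact hasDerivAt_pi.1 (hasDerivAt_pi.1 (ht hmem).fst i) p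
    refine .fun_sub (.fun_sum fun e he => .const_mul _ (hψderiv e he t hmem))
      (.fun_sum fun i _ => .const_mul _ (h1 i))
  -- the bounded part of the derivative
  obtain ⟨M₁, hM₁⟩ : ∃ M, ∀ t ∈ Ioo t₀ τ, M ≤ ∑ e ∈ S, c e * deriv (C.ψ e.1 e.2 p) t := by
    choose! B hB using hC.ψ_deriv_bdd
    refine ⟨∑ e ∈ S, c e * -(B e.1 e.2 p), fun t ht => Finset.sum_le_sum fun e he =>
      mul_le_mul_of_nonneg_left ?_ (hc e he)⟩
    have := hB e.1 e.2 ((hmemS e).1 he).1 p t ht.1.le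
    rw [derivWithin_of_mem_nhds (Ici_mem_nhds ht.1)] at this
    exact (abs_le.1 this).1
  obtain ⟨M₂, hM₂⟩ : ∃ M, ∀ t ∈ Ioo t₀ τ, ∑ i, x i * A.F i t (y t i) (z t i) p ≤ M := by
    have h1 : ∀ i, ∃ M, ∀ t ∈ Icc t₀ τ, ‖A.F i t (y t i) (z t i)‖ ≤ M := fun i => by
      have hci : ContinuousOn (fun t => (y t i, z t i)) (Icc t₀ τ) :=
        (by fun_prop : Continuous fun q : (Fin N → Fin m → ℝ) × (Fin N → Fin n → ℝ) =>
          (q.1 i, q.2 i)).comp_continuousOn hyz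
      obtain ⟨M, hM⟩ := hA.F_bdd i _ (isCompact_Icc.image_of_continuousOn hci)
      exact ⟨M, fun t ht => hM t ht.1 _ (mem_image_of_mem _ ht)⟩
    choose M hM using h1
    refine ⟨∑ i, |x i| * M i, fun t ht => Finset.sum_le_sum fun i _ => ?_⟩
    refine (le_abs_self _).trans ?_
    rw [abs_mul]
    exact mul_le_mul_of_nonneg_left
      ((norm_le_pi_norm (A.F i t (y t i) (z t i)) p).trans (hM i t (Ioo_subset_Icc_self ht)))
      (abs_nonneg _)
  -- the coupling part diverges
  have hcpl : ∀ i k, (∃ M, ∀ᶠ t in 𝓝[<] τ, M ≤ (x k - x i) * C.force G p t (y t) i k) ∧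
      ((i, k) ∈ S → Tendsto (fun t => (x k - x i) * C.force G p t (y t) i k) (𝓝[<] τ) atTop) := by
    intro i k
    by_cases hik : G.Adj i k
    · rcases force_eventually hC hτ hy hfun p hik with ⟨h, hl⟩ | ⟨h, hl⟩ | ⟨h, a, hl⟩
      · have hS : (i, k) ∈ S := (hmemS _).2 ⟨hik, by linarith⟩
        have hlt := hx _ hS
        have := hl.const_mul_atBot_of_neg (sub_neg.2 hlt)
        exact ⟨⟨0, this.eventually_ge_atTop 0⟩, fun _ => this⟩
      · have hS : (k, i) ∈ S := (hmemS _).2 ⟨hik.symm, by rw [← hC.ψ_symm i k hik p τ hτ.le, h]⟩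
        have hlt := hx _ hS
        have := hl.const_mul_atTop (sub_pos.2 hlt)
        exact ⟨⟨0, this.eventually_ge_atTop 0⟩, fun _ => this⟩
      · refine ⟨⟨(x k - x i) * a - 1, (hl.const_mul (x k - x i)).eventually_const_le
          (by linarith)⟩, fun hS => ?_⟩
        have h1 := ((hmemS _).1 hS).2
        have h2 := (abs_lt.1 h).1
        simp only at h1
        linarith
    · refine ⟨⟨0, .of_forall fun t => ?_⟩, fun hS => absurd ((hmemS _).1 hS).1 hik⟩
      simp [EdgeDesign.force, hik]
  have hdiv : Tendsto (fun t => ∑ e : Fin N × Fin N,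
      (x e.2 - x e.1) * C.force G p t (y t) e.1 e.2) (𝓝[<] τ) atTop :=
    tendsto_atTop_finset_sum _ _ (fun e _ => (hcpl e.1 e.2).1) (Finset.mem_univ (i₀, k₀))
      ((hcpl i₀ k₀).2 ((hmemS _).2 ⟨hadj, hsat⟩))
  have hV'1 : ∀ᶠ t in 𝓝[<] τ, 1 ≤ V' t := by
    -- V' is at least M₁ - M₂ plus half the coupling sum, the half because each edge is counted in
    -- both orientations. The threshold makes the total 1.
    filter_upwards [hdiv.eventually_ge_atTop (2 * (1 - M₁ + M₂)), Ioo_mem_nhdsLT hτ] with t ht hmem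
    have h1 : ∑ i, x i * ∑ k, C.force G p t (y t) i k =
        -(2⁻¹ * ∑ e : Fin N × Fin N, (x e.2 - x e.1) * C.force G p t (y t) e.1 e.2) := by
      rw [sum_mul_sum_of_antisymm x _
        (EdgeDesign.force_antisymm hC p hmem.1.le (hfun t (Ioo_subset_Ico_self hmem))),
        Fintype.sum_prod_type, ← mul_neg, ← Finset.sum_neg_distrib]
      simp only [← Finset.sum_neg_distrib, ← neg_mul, neg_sub]
    have h2 := hM₁ t hmem
    have h3 := hM₂ t hmem
    simp only [V', mul_add, Finset.sum_add_distrib, h1]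
    linarith
  obtain ⟨a, ha, hsub⟩ := (mem_nhdsLT_iff_exists_Ioo_subset' hτ).1 hV'1
  have ha : a < τ := ha
  let b := max a t₀
  have hb : b < τ := max_lt ha hτ
  -- With V τ = 0 this gives V b ≤ b - τ < 0, against the nonnegativity of V before τ.
  have hmono : V b - b ≤ V τ - τ := by
    refine AbsolutelyContinuousOnInterval.le_of_ae_hasDerivAt_nonneg (f := fun t => V t - t)
      (f' := fun t => V' t - 1) hb.le ?_ ?_
    · refine .fun_sub (hVac.mono ?_) LipschitzWith.id.lipschitzOnWith.absolutelyContinuousOnInterval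
      rw [uIcc_of_le hb.le, uIcc_of_le hτ.le]
      exact Icc_subset_Icc_left (le_max_right _ _)
    · filter_upwards [hVderiv] with t ht hmem
      have h1 : a < t := (le_max_left _ _).trans_lt hmem.1
      have h2 : t₀ < t := (le_max_right _ _).trans_lt hmem.1
      exact ⟨(ht ⟨h2, hmem.2⟩).sub (hasDerivAt_id t), sub_nonneg.2 (hsub ⟨h1, hmem.2⟩)⟩
  have := hVnn b ⟨le_max_right _ _, hb⟩
  linarith

/-- Solutions of the closed loop which start inside the funnels stay there. -/
theorem inFunnel_of_isCaratheodorySolution (hA : A.OpenLoopAssumption t₀)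
    (hΓ : A.GainAssumption t₀) (hC : C.Admissible G t₀) {ω : EReal}
    {y : ℝ → Fin N → Fin m → ℝ} {z : ℝ → Fin N → Fin n → ℝ}
    (hsol : IsCaratheodorySolution (A.closedLoop G C) t₀ ω fun t => (y t, z t))
    (h₀ : C.InFunnel G t₀ (y t₀)) {t : ℝ} (ht : t₀ ≤ t) (htω : (t : EReal) < ω) :
    C.InFunnel G t (y t) := by
  by_contra hout
  -- The exit times up to t form a finite union of closed sets, so a first one exists.
  let B : Set ℝ := ⋃ (i : Fin N) (k : Fin N) (p : Fin m) (_ : G.Adj i k),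
    {s ∈ Icc t₀ t | C.ψ i k p s ≤ |y s k p - y s i p|}
  have hmemB : ∀ s, s ∈ B ↔ s ∈ Icc t₀ t ∧ ¬C.InFunnel G s (y s) := fun s => by
    simp only [B, mem_iUnion, EdgeDesign.InFunnel, not_forall, not_lt]
    constructor
    · rintro ⟨i, k, p, h, hs⟩
      exact ⟨hs.1, i, k, h, p, hs.2⟩
    · rintro ⟨hs, i, k, h, p, hs'⟩
      exact ⟨i, k, p, h, hs, hs'⟩
  have hac := hsol.1 t ht htω
  have hyz : ContinuousOn (fun t => (y t, z t)) (Icc t₀ t) := by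
    simpa [uIcc_of_le ht] using hac.continuousOn
  have hy : ContinuousOn y (Icc t₀ t) := continuous_fst.comp_continuousOn hyz
  have hcomp : ∀ j p, ContinuousOn (fun t => y t j p) (Icc t₀ t) := fun j p =>
    (continuous_apply_apply j p).comp_continuousOn hy
  have hBcl : IsClosed B := by
    refine isClosed_iUnion_of_finite fun i => isClosed_iUnion_of_finite fun k =>
      isClosed_iUnion_of_finite fun p => isClosed_iUnion_of_finite fun h => ?_
    exact isClosed_Icc.isClosed_le
      ((hC.ψ_contDiff i k h p).continuousOn.mono Icc_subset_Ici_self)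
      ((hcomp k p).sub (hcomp i p)).abs
  have hBbdd : BddBelow B := ⟨t₀, fun s hs => ((hmemB s).1 hs).1.1⟩
  have hτB : sInf B ∈ B := hBcl.csInf_mem ⟨t, (hmemB t).2 ⟨⟨ht, le_rfl⟩, hout⟩⟩ hBbdd
  generalize hτdef : sInf B = τ at hτB
  obtain ⟨⟨hτ₀, hτt⟩, hτout⟩ := (hmemB τ).1 hτB
  have hτ : t₀ < τ := hτ₀.lt_of_ne fun h => hτout (h ▸ h₀)
  have hfun : ∀ s ∈ Ico t₀ τ, C.InFunnel G s (y s) := fun s hs => by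
    by_contra hs'
    have := csInf_le hBbdd ((hmemB s).2 ⟨⟨hs.1, hs.2.le.trans hτt⟩, hs'⟩)
    linarith [hs.2]
  have hac' : AbsolutelyContinuousOnInterval (fun t => (y t, z t)) t₀ τ := hac.mono <| by
    rw [uIcc_of_le hτ.le, uIcc_of_le ht]
    exact Icc_subset_Icc_right hτt
  have hode : ∀ᵐ s : ℝ, s ∈ Ioo t₀ τ →
      HasDerivAt (fun t => (y t, z t)) (A.closedLoop G C s (y s, z s)) s := by
    filter_upwards [hsol.2] with s hs hmem
    exact hs hmem.1 ((EReal.coe_lt_coe_iff.2 (hmem.2.trans_le hτt)).trans htω)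
  obtain ⟨i, k, h, p, hik⟩ : ∃ i k, ∃ (_ : G.Adj i k), ∃ p, C.ψ i k p τ ≤ |y τ k p - y τ i p| := by
    simpa [EdgeDesign.InFunnel] using hτout
  rcases force_eventually hC hτ (hy.mono (Icc_subset_Icc_right hτt)) hfun p h with
    ⟨h1, -⟩ | ⟨h1, -⟩ | ⟨h1, -⟩
  · exact not_saturated hA hΓ hC hτ hac' hode hfun h (by linarith)
  · exact not_saturated hA hΓ hC hτ hac' hode hfun h.symm
      (by rw [← hC.ψ_symm i k h p τ hτ.le, h1])
  · exact absurd hik (not_le.2 h1)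

end AgentFamily

/-! ### Comparison functions -/

/-- A relation between `r` and `δ` which bounds `δ`, and forces it to `0` as `r → 0`, is dominated
by a function of class `𝒦_∞`. -/
theorem exists_isClassKInf_dominating (R : ℝ → ℝ → Prop) (B : ℝ) (hB : ∀ r δ, R r δ → δ ≤ B)
    (h₀ : ∀ ε > 0, ∃ η > 0, ∀ r δ, r ≤ η → R r δ → δ ≤ ε) :
    ∃ γ : ℝ → ℝ, IsClassKInf γ ∧ ∀ r δ, 0 ≤ r → R r δ → δ ≤ γ r := by
  -- Weights |B|, 1, 1/2, 1/4, …. The k-th summand of γ reaches its full weight once r ≥ η k, and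
  -- |r| keeps the summands nonnegative on all of ℝ for the M-test.
  let a : ℕ → ℝ := fun k => Nat.casesOn k |B| fun k => (1 / 2) ^ k
  have ha : ∀ k, 0 ≤ a k := by
    rintro (_ | k)
    · exact abs_nonneg B
    · exact pow_nonneg (by norm_num) k
  have hsum : Summable a := (summable_nat_add_iff 1).1 summable_geometric_two
  choose η hη hηR using fun k : ℕ => h₀ ((1 / 2) ^ k) (by positivity)
  let T : ℕ → ℝ → ℝ := fun k r => a k * min 1 (|r| / η k)
  have hT0 : ∀ k r, 0 ≤ T k r := fun k r =>
    mul_nonneg (ha k) (le_min zero_le_one (div_nonneg (abs_nonneg _) (hη k).le))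
  have hTa : ∀ k r, T k r ≤ a k := fun k r => mul_le_of_le_one_right (ha k) (min_le_left _ _)
  have hTs : ∀ r, Summable fun k => T k r := fun r =>
    hsum.of_nonneg_of_le (fun k => hT0 k r) fun k => hTa k r
  have hcont : Continuous fun r => ∑' k, T k r := by
    refine continuous_tsum (u := a) (fun k => by fun_prop) hsum fun k r => ?_
    rw [Real.norm_of_nonneg (hT0 k r)]
    exact hTa k r
  have hnn : ∀ r, 0 ≤ ∑' k, T k r := fun r => tsum_nonneg fun k => hT0 k r
  refine ⟨fun r => r + ∑' k, T k r, ⟨⟨?_, ?_, ?_⟩, ?_⟩, fun r δ hr hR => ?_⟩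
  · exact (continuous_id.add hcont).continuousOn
  · intro r hr s hs hrs
    refine add_lt_add_of_lt_of_le hrs ((hTs r).tsum_le_tsum (fun k => ?_) (hTs s))
    refine mul_le_mul_of_nonneg_left (min_le_min le_rfl ?_) (ha k)
    rw [abs_of_nonneg hr, abs_of_nonneg hs]
    exact div_le_div_of_nonneg_right hrs.le (hη k).le
  · simp [T]
  · exact tendsto_atTop_mono (fun r => le_add_of_nonneg_right (hnn r)) tendsto_id
  · have hterm : ∀ k, η k ≤ r → a k ≤ r + ∑' k, T k r := fun k hk => by
      have h1 : T k r = a k := by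
        have : 1 ≤ |r| / η k := by rwa [one_le_div (hη k), abs_of_nonneg hr]
        simp [T, min_eq_left this]
      have h2 := (hTs r).le_tsum k fun j _ => hT0 j r
      linarith
    -- Take the least k with η k ≤ r. If k = 0, the weight |B| bounds δ; for an index k + 1, r < η k
    -- gives δ ≤ (1/2)^k, which is exactly the weight `a (k + 1)`.
    by_cases hex : ∃ k, η k ≤ r
    · classical
      have hk := Nat.find_spec hex
      rcases hfind : Nat.find hex with _ | k
      · rw [hfind] at hk
        exact ((hB r δ hR).trans (le_abs_self B)).trans (hterm 0 hk)
      · rw [hfind] at hk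
        have hlt : r < η k := not_le.1 (Nat.find_min hex (by omega))
        exact (hηR k r δ hlt.le hR).trans (hterm (k + 1) hk)
    · push Not at hex
      have h1 : δ ≤ 0 := ge_of_tendsto' (tendsto_pow_atTop_nhds_zero_of_lt_one
        (by norm_num : (0 : ℝ) ≤ 1 / 2) (by norm_num)) fun k => hηR k r δ (hex k).le hR
      linarith [hnn r]

theorem IsClassK.nonneg {γ : ℝ → ℝ} (h : IsClassK γ) {r : ℝ} (hr : 0 ≤ r) : 0 ≤ γ r :=
  h.map_zero.symm.le.trans (h.strictMonoOn.monotoneOn (mem_Ici.2 le_rfl) hr hr)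

theorem IsClassK.mono {γ : ℝ → ℝ} (h : IsClassK γ) {r s : ℝ} (hr : 0 ≤ r) (hrs : r ≤ s) :
    γ r ≤ γ s :=
  h.strictMonoOn.monotoneOn hr (hr.trans hrs : (0 : ℝ) ≤ s) hrs

/-! ### Fading memory -/

theorem IsCaratheodorySolution.restart {E : Type*} [NormedAddCommGroup E] [NormedSpace ℝ E]
    {f : ℝ → E → E} {τ τ' : ℝ} {x : ℝ → E} (h : IsCaratheodorySolution f τ ⊤ x) (hτ : τ ≤ τ') :
    IsCaratheodorySolution f τ' ⊤ x := by
  refine ⟨fun T hT hT' => (h.1 T (hτ.trans hT) hT').mono ?_, ?_⟩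
  · rw [uIcc_of_le hT, uIcc_of_le (hτ.trans hT)]
    exact Icc_subset_Icc_left hτ
  · filter_upwards [h.2] with t ht h1 h2
    exact ht (hτ.trans_lt h1) h2

theorem IsAdmissibleInput.restart {U : Type*} [NormedAddCommGroup U] {τ τ' : ℝ} {u : ℝ → U}
    (h : IsAdmissibleInput τ u) (hτ : τ ≤ τ') : IsAdmissibleInput τ' u := by
  refine ⟨h.1.mono_measure (Measure.restrict_mono (Ici_subset_Ici.2 hτ) le_rfl), fun T => ?_⟩
  obtain ⟨M, hM⟩ := h.2 T
  exact ⟨M, ae_mono (Measure.restrict_mono (Icc_subset_Icc_left hτ) le_rfl) hM⟩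

namespace IsDeltaISS

variable {E U : Type*} [NormedAddCommGroup E] [NormedSpace ℝ E] [NormedAddCommGroup U]
  {t₀ : ℝ} {f : ℝ → E → U → E} {β : ℝ → ℝ → ℝ} {γ' : ℝ → ℝ}

/-- A solution on a compact interval extends to a global one. -/
theorem exists_extension (h : IsDeltaISS t₀ f β γ') {T : ℝ} (hT : t₀ ≤ T) {u : ℝ → U}
    (hu : IsAdmissibleInput t₀ u) {x : ℝ → E} (hac : AbsolutelyContinuousOnInterval x t₀ T)
    (hode : ∀ᵐ t : ℝ, t ∈ Ioo t₀ T → HasDerivAt x (f t (x t) (u t)) t) :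
    ∃ x' : ℝ → E, IsCaratheodorySolution (fun t ξ => f t ξ (u t)) t₀ ⊤ x' ∧
      EqOn x' x (Icc t₀ T) := by
  obtain ⟨x₁, hx₁, hsol⟩ := h.complete T hT (x T) u (hu.restart hT)
  let x' : ℝ → E := fun t => if t ≤ T then x t else x₁ t
  have hl : ∀ t, t ≤ T → x' t = x t := fun t ht => if_pos ht
  have hr : ∀ t, T ≤ t → x' t = x₁ t := fun t ht => by
    rcases ht.eq_or_lt with rfl | ht
    · rw [hl _ le_rfl, hx₁]
    · exact if_neg (not_le.2 ht)
  have hac' : AbsolutelyContinuousOnInterval x' t₀ T := hac.congr fun t ht => by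
    rw [uIcc_of_le hT] at ht
    exact (hl t ht.2).symm
  refine ⟨x', ⟨fun S hS _ => ?_, ?_⟩, fun t ht => hl t ht.2⟩
  · rcases le_total S T with hST | hST
    · refine hac'.mono ?_
      rw [uIcc_of_le hS, uIcc_of_le hT]
      exact Icc_subset_Icc_right hST
    · refine hac'.trans hT hST ((hsol.1 S hST (EReal.coe_lt_top S)).congr fun t ht => ?_)
      rw [uIcc_of_le hST] at ht
      exact (hr t ht.1).symm
  · filter_upwards [hode, hsol.2, Measure.ae_ne volume T] with t h1 h2 hne ht₀ htop
    rcases lt_or_gt_of_ne hne with hlt | hgt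
    · rw [hl t hlt.le]
      refine (h1 ⟨ht₀, hlt⟩).congr_of_eventuallyEq ?_
      filter_upwards [Iio_mem_nhds hlt] with s hs using hl s (le_of_lt hs)
    · rw [hr t hgt.le]
      refine (h2 hgt htop).congr_of_eventuallyEq ?_
      filter_upwards [Ioi_mem_nhds hgt] with s hs using hr s (le_of_lt hs)

/-- `δ`-ISS with fading memory: for solutions with the same initial value, the past differences of
the inputs are discounted by `w`. -/
theorem exists_fading_gain (h : IsDeltaISS t₀ f β γ') {w : ℝ → ℝ} (hw_anti : AntitoneOn w (Ici 0))
    (hw_mem : ∀ t, 0 ≤ t → w t ∈ Ioc (0 : ℝ) 1) {M : ℝ} (hM : 0 ≤ M) :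
    ∃ γ : ℝ → ℝ, IsClassKInf γ ∧
      ∀ u u' : ℝ → U, IsAdmissibleInput t₀ u → IsAdmissibleInput t₀ u' → ∀ x x' : ℝ → E,
        IsCaratheodorySolution (fun t ξ => f t ξ (u t)) t₀ ⊤ x →
        IsCaratheodorySolution (fun t ξ => f t ξ (u' t)) t₀ ⊤ x' → x' t₀ = x t₀ →
        ∀ (v : ℝ → ℝ) (t : ℝ), t₀ ≤ t →
          (∀ s ∈ Ico t₀ t, ‖u' s - u s‖ ≤ v s ∧ v s ≤ M) →
          ‖x' t - x t‖ ≤ γ (sSup ((fun s => v s * w (t - s)) '' Ico t₀ t)) := by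
  have hK := h.classKInf.toIsClassK
  have hC : 0 ≤ γ' M := hK.nonneg hM
  obtain ⟨γ, hγ, hdom⟩ := exists_isClassKInf_dominating
    (fun r δ => 0 ≤ r ∧ δ ≤ γ' M ∧ ∀ a, 0 ≤ a → δ ≤ β (γ' M) a + γ' (r / w a)) (γ' M)
    (fun r δ h => h.2.1) (fun ε hε => by
      -- The lag a is fixed first to make the β term small; only then is r made small relative to
      -- w(a).
      obtain ⟨a, ha0, ha⟩ := ((eventually_ge_atTop 0).and
        ((h.classKL.tendsto_zero _ hC).eventually_lt_const (half_pos hε))).exists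
      have hwa := (hw_mem a ha0).1
      have h1 : Tendsto γ' (𝓝[Ici 0] 0) (𝓝 0) := by
        simpa [hK.map_zero] using (hK.continuousOn 0 (mem_Ici.2 le_rfl)).tendsto
      obtain ⟨η, hη, hsub⟩ := Metric.mem_nhdsWithin_iff.1 (h1.eventually_lt_const (half_pos hε))
      refine ⟨η / 2 * w a, by positivity, fun r δ hr hR => ?_⟩
      have h2 : r / w a ≤ η / 2 := (div_le_iff₀ hwa).2 hr
      have h3 : 0 ≤ r / w a := div_nonneg hR.1 hwa.le
      have h4 : γ' (r / w a) < ε / 2 := hsub ⟨by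
        rw [Metric.mem_ball, Real.dist_eq, sub_zero, abs_of_nonneg h3]
        linarith, h3⟩
      linarith [hR.2.2 a ha0])
  refine ⟨γ, hγ, fun u u' hu hu' x x' hx hx' h0 v t ht hv => ?_⟩
  have hbdd : ∀ τ t₁, t₀ ≤ τ → t₁ ≤ t →
      BddAbove ((fun s => ‖u' s - u s‖) '' Ico τ t₁) := by
    rintro τ t₁ hτ ht₁
    refine ⟨M, ?_⟩
    rintro _ ⟨s, hs, rfl⟩
    have := hv s ⟨hτ.trans hs.1, hs.2.trans_le ht₁⟩
    exact this.1.trans this.2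
  have hest : ∀ τ t₁ D, t₀ ≤ τ → τ ≤ t₁ → t₁ ≤ t → 0 ≤ D →
      (∀ s ∈ Ico τ t₁, v s ≤ D) → ‖x' t₁ - x t₁‖ ≤ β ‖x' τ - x τ‖ (t₁ - τ) + γ' D := by
    intro τ t₁ D hτ hτt₁ ht₁ hD hvD
    refine (h.estimate τ hτ u u' (hu.restart hτ) (hu'.restart hτ) x x' (hx.restart hτ)
      (hx'.restart hτ) t₁ hτt₁ (hbdd τ t₁ hτ ht₁)).trans ?_
    gcongr
    refine hK.mono (Real.sSup_nonneg ?_) (Real.sSup_le ?_ hD)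
    · rintro _ ⟨s, -, rfl⟩
      exact norm_nonneg _
    · rintro _ ⟨s, hs, rfl⟩
      exact (hv s ⟨hτ.trans hs.1, hs.2.trans_le ht₁⟩).1.trans (hvD s hs)
  have hβ0 : ∀ s, 0 ≤ s → β 0 s = 0 := fun s hs => (h.classKL.classK s hs).map_zero
  have hunif : ∀ t₁, t₀ ≤ t₁ → t₁ ≤ t → ‖x' t₁ - x t₁‖ ≤ γ' M := fun t₁ h₁ h₂ => by
    have := hest t₀ t₁ M le_rfl h₁ h₂ hM fun s hs => (hv s ⟨hs.1, hs.2.trans_le h₂⟩).2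
    rwa [h0, sub_self, norm_zero, hβ0 _ (sub_nonneg.2 h₁), zero_add] at this
  set D := sSup ((fun s => v s * w (t - s)) '' Ico t₀ t)
  have hv0 : ∀ s ∈ Ico t₀ t, 0 ≤ v s := fun s hs => (norm_nonneg _).trans (hv s hs).1
  have hwm : ∀ s ∈ Ico t₀ t, w (t - s) ∈ Ioc (0 : ℝ) 1 := fun s hs =>
    hw_mem _ (sub_nonneg.2 hs.2.le)
  have hD : 0 ≤ D := Real.sSup_nonneg <| by
    rintro _ ⟨s, hs, rfl⟩
    exact mul_nonneg (hv0 s hs) (hwm s hs).1.le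
  have hDle : ∀ s ∈ Ico t₀ t, v s * w (t - s) ≤ D := fun s hs => by
    refine le_csSup ⟨M, ?_⟩ (mem_image_of_mem _ hs)
    rintro _ ⟨r, hr, rfl⟩
    exact (mul_le_of_le_one_right (hv0 r hr) (hwm r hr).2).trans (hv r hr).2
  refine hdom D _ hD ⟨hD, hunif t ht le_rfl, fun a ha => ?_⟩
  have hwa := (hw_mem a ha).1
  -- On the last a time units the discount is at least w(a), so the undiscounted input difference is
  -- at most D / w(a).
  have hvD : ∀ s ∈ Ico (max t₀ (t - a)) t, v s ≤ D / w a := fun s hs => by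
    have hs' : s ∈ Ico t₀ t := ⟨(le_max_left _ _).trans hs.1, hs.2⟩
    have h1 : t - s ≤ a := by linarith [(le_max_right _ _).trans hs.1]
    have h2 : w a ≤ w (t - s) := hw_anti (mem_Ici.2 (sub_nonneg.2 hs.2.le)) (mem_Ici.2 ha) h1
    rw [le_div_iff₀ hwa]
    exact (mul_le_mul_of_nonneg_left h2 (hv0 s hs')).trans (hDle s hs')
  have hτt : max t₀ (t - a) ≤ t := max_le ht (by linarith)
  refine (hest _ t _ (le_max_left _ _) hτt le_rfl (div_nonneg hD hwa.le) hvD).trans ?_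
  gcongr
  -- If the lag reaches back beyond t₀, the restart is at t₀, where the states agree and the β term
  -- vanishes.
  rcases le_total (t - a) t₀ with hle | hle
  · rw [max_eq_left hle, h0, sub_self, norm_zero, hβ0 _ (sub_nonneg.2 ht)]
    exact (h.classKL.classK a ha).nonneg hC
  · rw [max_eq_right hle, sub_sub_cancel]
    exact (h.classKL.classK a ha).mono (norm_nonneg _) (hunif _ hle (by linarith))

end IsDeltaISS

/-! ### Synchronisation inside the funnels -/

namespace EdgeDesign

variable {N m : ℕ} {C : EdgeDesign N m} {G : SimpleGraph (Fin N)} {t₀ : ℝ}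

theorem le_maxWidth {i j : Fin N} (h : G.Adj i j) (p : Fin m) (t : ℝ) :
    C.ψ i j p t ≤ C.maxWidth G t := by
  refine le_csSup (((Set.finite_range fun e : Fin N × Fin N × Fin m =>
    C.ψ e.1 e.2.1 e.2.2 t).subset ?_).bddAbove) ⟨i, j, p, h, rfl⟩
  rintro _ ⟨i, j, p, -, rfl⟩
  exact ⟨(i, j, p), rfl⟩

theorem maxWidth_nonneg (hC : C.Admissible G t₀) {t : ℝ} (ht : t₀ ≤ t) : 0 ≤ C.maxWidth G t :=
  Real.sSup_nonneg <| by
    rintro _ ⟨i, j, p, h, rfl⟩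
    exact (hC.ψ_pos i j h p t ht).le

theorem exists_maxWidth_le (hC : C.Admissible G t₀) :
    ∃ M, 0 ≤ M ∧ ∀ t, t₀ ≤ t → C.maxWidth G t ≤ M := by
  choose! B hB using hC.ψ_bdd
  refine ⟨∑ e : Fin N × Fin N × Fin m, |B e.1 e.2.1 e.2.2|,
    Finset.sum_nonneg fun _ _ => abs_nonneg _, fun t ht => Real.sSup_le ?_
      (Finset.sum_nonneg fun _ _ => abs_nonneg _)⟩
  rintro _ ⟨i, j, p, h, rfl⟩
  refine (((le_abs_self _).trans (hB i j h p t ht)).trans (le_abs_self _)).trans ?_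
  exact Finset.single_le_sum (f := fun e : Fin N × Fin N × Fin m => |B e.1 e.2.1 e.2.2|)
    (fun _ _ => abs_nonneg _) (Finset.mem_univ (i, j, p))

/-- Each edge of a shortest walk contributes at most Ψ(t), and its length is at most the diameter.
-/
theorem InFunnel.norm_sub_le {t : ℝ} {y : Fin N → Fin m → ℝ} (h : C.InFunnel G t y)
    (hG : G.Connected) (h0 : 0 ≤ C.maxWidth G t) (i j : Fin N) :
    ‖y i - y j‖ ≤ G.diam * C.maxWidth G t := by
  have hwalk : ∀ {i j : Fin N} (q : G.Walk i j), ‖y i - y j‖ ≤ q.length * C.maxWidth G t := by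
    intro i j q
    induction q with
    | nil => simp
    | @cons a b c hab q ih =>
      have h1 : ‖y a - y b‖ ≤ C.maxWidth G t := (pi_norm_le_iff_of_nonneg h0).2 fun p => by
        rw [Pi.sub_apply, Real.norm_eq_abs, abs_sub_comm]
        exact (h a b hab p).le.trans (le_maxWidth hab p t)
      have h2 := norm_sub_le_norm_sub_add_norm_sub (y a) (y b) (y c)
      rw [SimpleGraph.Walk.length_cons]
      push_cast
      linarith
  obtain ⟨q, hq⟩ := hG.exists_walk_length_eq_dist i j
  have : Nonempty (Fin N) := ⟨i⟩
  have hd := SimpleGraph.dist_le_diam (SimpleGraph.connected_iff_ediam_ne_top.1 hG) (u := i) (v := j)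
  refine (hwalk q).trans (mul_le_mul_of_nonneg_right ?_ h0)
  rw [hq]
  exact_mod_cast hd

theorem InFunnel.norm_sub_mean_le {t : ℝ} {y : Fin N → Fin m → ℝ} (h : C.InFunnel G t y)
    (hG : G.Connected) (h0 : 0 ≤ C.maxWidth G t) (i : Fin N) :
    ‖y i - (N : ℝ)⁻¹ • ∑ j, y j‖ ≤ G.diam * C.maxWidth G t := by
  have hN : (N : ℝ) ≠ 0 := by
    have := i.pos
    positivity
  -- The deviation from the mean is the average of the pairwise differences.
  have h1 : y i - (N : ℝ)⁻¹ • ∑ j, y j = (N : ℝ)⁻¹ • ∑ j, (y i - y j) := by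
    rw [Finset.sum_sub_distrib, smul_sub, Finset.sum_const, Finset.card_univ, Fintype.card_fin,
      ← Nat.cast_smul_eq_nsmul ℝ, inv_smul_smul₀ hN]
  rw [h1, norm_smul, norm_inv, Real.norm_natCast, inv_mul_le_iff₀ (by positivity)]
  refine (norm_sum_le_of_le _ fun j _ => h.norm_sub_le hG h0 i j).trans ?_
  simp

end EdgeDesign

/-! ### The blended dynamics -/

namespace AgentFamily

variable {N m n : ℕ} {A : AgentFamily N m n} {G : SimpleGraph (Fin N)} [DecidableRel G.Adj]
  {C : EdgeDesign N m} {t₀ : ℝ}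

/-- The coupling does not act on the mean. -/
theorem mean_closedLoop (hΓ : A.GainAssumption t₀) (hC : C.Admissible G t₀) {t : ℝ} (ht : t₀ ≤ t)
    (x : (Fin N → Fin m → ℝ) × (Fin N → Fin n → ℝ)) (h : C.InFunnel G t x.1) :
    ∑ i, (A.closedLoop G C t x).1 i = ∑ i, A.F i t (x.1 i) (x.2 i) := by
  ext p
  have h1 := sum_mul_sum_of_antisymm (fun _ : Fin N => (1 : ℝ)) _
    (EdgeDesign.force_antisymm hC p ht h)
  simp only [one_mul, sub_self, zero_mul, Finset.sum_const_zero, mul_zero] at h1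
  simp only [Finset.sum_apply, closedLoop_fst_apply hΓ ht, Finset.sum_add_distrib, h1, add_zero]

/-- The mean of the outputs, together with the internal states. -/
noncomputable def meanMap (N m n : ℕ) : (Fin N → Fin m → ℝ) × (Fin N → Fin n → ℝ) →L[ℝ]
    (Fin m → ℝ) × (Fin N → Fin n → ℝ) :=
  ((N : ℝ)⁻¹ • ∑ i, (ContinuousLinearMap.proj i).comp (ContinuousLinearMap.fst ℝ _ _)).prod
    (ContinuousLinearMap.snd ℝ _ _)

theorem meanMap_apply (x : (Fin N → Fin m → ℝ) × (Fin N → Fin n → ℝ)) :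
    meanMap N m n x = ((N : ℝ)⁻¹ • ∑ i, x.1 i, x.2) := by
  simp [meanMap]

/-- Copies the internal state of the reduced-order dynamics to all agents. -/
noncomputable def diagMap (N m n : ℕ) : (Fin m → ℝ) × (Fin n → ℝ) →L[ℝ]
    (Fin m → ℝ) × (Fin N → Fin n → ℝ) :=
  (ContinuousLinearMap.fst ℝ _ _).prod
    (ContinuousLinearMap.pi fun _ => ContinuousLinearMap.snd ℝ _ _)

theorem diagMap_apply (x : (Fin m → ℝ) × (Fin n → ℝ)) :
    diagMap N m n x = (x.1, fun _ => x.2) := rfl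

/-- The diagonal z₁ = … = z_N is invariant because all agents share the same Z. -/
theorem diagMap_reducedBlended (t : ℝ) (x : (Fin m → ℝ) × (Fin n → ℝ)) :
    diagMap N m n (A.reducedBlended t x) = A.perturbedBlended t (diagMap N m n x) 0 := by
  simp [diagMap_apply, reducedBlended, perturbedBlended]

theorem meanMap_closedLoop (hΓ : A.GainAssumption t₀) (hC : C.Admissible G t₀) {t : ℝ}
    (ht : t₀ ≤ t) (x : (Fin N → Fin m → ℝ) × (Fin N → Fin n → ℝ)) (h : C.InFunnel G t x.1) :
    meanMap N m n (A.closedLoop G C t x) = A.perturbedBlended t (meanMap N m n x)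
      (fun i => x.1 i - (meanMap N m n x).1) := by
  rw [meanMap_apply, meanMap_apply, mean_closedLoop hΓ hC ht x h]
  simp [perturbedBlended, closedLoop]

end AgentFamily

/-- Freezing the input at time T makes it global, as δ-ISS requires, without changing it on [t₀, T].
-/
theorem isAdmissibleInput_comp_min {U : Type*} [NormedAddCommGroup U] {t₀ T : ℝ} (hT : t₀ ≤ T)
    {e : ℝ → U} (he : ContinuousOn e (Icc t₀ T)) :
    IsAdmissibleInput t₀ fun t => e (min t T) := by
  have hmaps : MapsTo (fun t => min t T) (Ici t₀) (Icc t₀ T) := fun t ht =>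
    ⟨le_min ht hT, min_le_right _ _⟩
  have hc : ContinuousOn (fun t => e (min t T)) (Ici t₀) :=
    he.comp (by fun_prop) hmaps
  obtain ⟨M, hM⟩ := isCompact_Icc.exists_bound_of_continuousOn he
  refine ⟨?_, fun S => ⟨M, ?_⟩⟩
  · exact hc.aestronglyMeasurable measurableSet_Ici
  · rw [ae_restrict_iff' measurableSet_Icc]
    exact .of_forall fun t ht => hM _ (hmaps ht.1)

theorem corollary2 {N m n : ℕ} (t₀ : ℝ) (A : AgentFamily N m n)
    (G : SimpleGraph (Fin N)) [DecidableRel G.Adj] (C : EdgeDesign N m)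
    (hA : A.OpenLoopAssumption t₀) (hΓ : A.GainAssumption t₀) (hG : G.Connected)
    (hC : C.Admissible G t₀) (hfin : NoFiniteEscape A G C t₀)
    (β : ℝ → ℝ → ℝ) (γ' : ℝ → ℝ) (hδ : IsDeltaISS t₀ A.perturbedBlended β γ')
    (w : ℝ → ℝ) (hw_anti : AntitoneOn w (Ici 0)) (hw_mem : ∀ t, 0 ≤ t → w t ∈ Ioc (0 : ℝ) 1)
    (hw_lim : Tendsto w atTop (𝓝 0)) :
    ∃ γ : ℝ → ℝ, IsClassKInf γ ∧
      ∀ (ω : EReal) (y : ℝ → Fin N → Fin m → ℝ) (z : ℝ → Fin N → Fin n → ℝ)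
        (s' : ℝ → Fin m → ℝ) (z' : ℝ → Fin n → ℝ),
        IsCaratheodorySolution (A.closedLoop G C) t₀ ω (fun t => (y t, z t)) →
        C.InFunnel G t₀ (y t₀) →
        IsCaratheodorySolution A.reducedBlended t₀ ω (fun t => (s' t, z' t)) →
        s' t₀ = (N : ℝ)⁻¹ • ∑ i, y t₀ i →
        ∀ (i : Fin N) (t : ℝ), t₀ ≤ t → (t : EReal) < ω →
          ‖(y t i, z t i) - (s' t, z' t)‖ ≤
            β (⨆ j, ‖z t₀ j - z' t₀‖) (t - t₀) +
            γ (sSup ((fun s => G.diam * C.maxWidth G s * w (t - s)) '' Ico t₀ t)) +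
            G.diam * C.maxWidth G t := by
  obtain ⟨M, hM0, hM⟩ := EdgeDesign.exists_maxWidth_le hC
  have hdM : 0 ≤ G.diam * M := by positivity
  -- γ depends on the trajectories only through the global bound d_G M, so it is fixed before ω and
  -- the solutions.
  obtain ⟨γ, hγ, hfade⟩ := hδ.exists_fading_gain hw_anti hw_mem hdM
  refine ⟨γ, hγ, fun ω y z s' z' hsol h₀ hred hs₀ i t ht htω => ?_⟩
  have hlt : ∀ s ∈ Ioo t₀ t, (s : EReal) < ω := fun s hs =>
    (EReal.coe_lt_coe_iff.2 hs.2).trans htω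
  have hfun : ∀ s ∈ Icc t₀ t, C.InFunnel G s (y s) := fun s hs =>
    AgentFamily.inFunnel_of_isCaratheodorySolution hA hΓ hC hsol h₀ hs.1
      ((EReal.coe_le_coe_iff.2 hs.2).trans_lt htω)
  have hmw : ∀ s, t₀ ≤ s → 0 ≤ C.maxWidth G s := fun s hs => EdgeDesign.maxWidth_nonneg hC hs
  -- the mean solves the perturbed blended dynamics
  let X : ℝ → (Fin m → ℝ) × (Fin N → Fin n → ℝ) := fun s =>
    AgentFamily.meanMap N m n (y s, z s)
  let e : ℝ → Fin N → Fin m → ℝ := fun s j => y s j - (X s).1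
  have hX : ∀ s, X s = ((N : ℝ)⁻¹ • ∑ j, y s j, z s) := fun s => AgentFamily.meanMap_apply _
  have hac := hsol.1 t ht htω
  have hXac : AbsolutelyContinuousOnInterval X t₀ t :=
    hac.comp_lipschitzWith (AgentFamily.meanMap N m n).lipschitz
  have hec : ContinuousOn e (Icc t₀ t) := by
    have h1 := hac.continuousOn
    have h2 := hXac.continuousOn
    rw [uIcc_of_le ht] at h1 h2
    exact (by fun_prop : Continuous fun q : ((Fin N → Fin m → ℝ) × (Fin N → Fin n → ℝ)) ×
      ((Fin m → ℝ) × (Fin N → Fin n → ℝ)) => fun j => q.1.1 j - q.2.1).comp_continuousOn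
      (h1.prodMk h2)
  have heb : ∀ s ∈ Icc t₀ t, ∀ j, ‖e s j‖ ≤ G.diam * C.maxWidth G s := fun s hs j => by
    simpa only [e, hX] using (hfun s hs).norm_sub_mean_le hG (hmw s hs.1) j
  have hu := isAdmissibleInput_comp_min ht hec
  have h0 : IsAdmissibleInput t₀ fun _ => (0 : Fin N → Fin m → ℝ) :=
    ⟨aestronglyMeasurable_const, fun _ => ⟨0, by simp⟩⟩
  obtain ⟨x, hx, hxX⟩ := hδ.exists_extension ht hu hXac <| by
    filter_upwards [hsol.2] with s hs hmem
    have h1 := (AgentFamily.meanMap N m n).hasFDerivAt.comp_hasDerivAt s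
      (hs hmem.1 (hlt s hmem))
    rw [AgentFamily.meanMap_closedLoop hΓ hC hmem.1.le _ (hfun s (Ioo_subset_Icc_self hmem))] at h1
    rw [min_eq_left hmem.2.le]
    exact h1
  -- the reduced-order dynamics solves the unperturbed blended dynamics
  obtain ⟨x', hx', hxX'⟩ := hδ.exists_extension ht h0
    (x := fun s => AgentFamily.diagMap N m n (s' s, z' s))
    ((hred.1 t ht htω).comp_lipschitzWith (AgentFamily.diagMap N m n).lipschitz) <| by
      filter_upwards [hred.2] with s hs hmem
      have h1 := (AgentFamily.diagMap N m n).hasFDerivAt.comp_hasDerivAt s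
        (hs hmem.1 (hlt s hmem))
      rwa [AgentFamily.diagMap_reducedBlended] at h1
  replace hxX' : ∀ s ∈ Icc t₀ t, x' s = AgentFamily.diagMap N m n (s' s, z' s) := hxX'
  -- The intermediate trajectory: zero input like `x'`, initial value of `x`.
  obtain ⟨x₁, hx₁0, hx₁⟩ := hδ.complete t₀ le_rfl (x t₀) _ h0
  have hleft : t₀ ∈ Icc t₀ t := left_mem_Icc.2 ht
  have hright : t ∈ Icc t₀ t := right_mem_Icc.2 ht
  -- The first components agree because the reduced dynamics starts at the mean output.
  have hinit : ‖x₁ t₀ - x' t₀‖ = ⨆ j, ‖z t₀ j - z' t₀‖ := by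
    have : Nonempty (Fin N) := ⟨i⟩
    rw [hx₁0, hxX hleft, hxX' _ hleft, hX, AgentFamily.diagMap_apply, hs₀, Prod.mk_sub_mk, sub_self,
      Prod.norm_mk, norm_zero, max_eq_right (norm_nonneg _)]
    refine le_antisymm ((pi_norm_le_iff_of_nonempty _).2 fun j => ?_) (ciSup_le fun j => ?_)
    · exact le_ciSup (f := fun j => ‖z t₀ j - z' t₀‖) (Set.finite_range _).bddAbove j
    · exact norm_le_pi_norm (z t₀ - fun _ => z' t₀) j
  have hest := hδ.estimate t₀ le_rfl _ _ h0 h0 x' x₁ hx' hx₁ t ht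
    ⟨0, by rintro _ ⟨s, -, rfl⟩; simp⟩
  have hsup : sSup ((fun _ : ℝ => ‖(0 : Fin N → Fin m → ℝ) - 0‖) '' Ico t₀ t) = 0 := by
    refine le_antisymm (Real.sSup_le ?_ le_rfl) (Real.sSup_nonneg ?_) <;>
      · rintro _ ⟨s, -, rfl⟩
        simp
  rw [hsup, hδ.classKInf.map_zero, add_zero, hinit] at hest
  have hf := hfade _ _ h0 hu x₁ x hx₁ hx hx₁0.symm (fun s => G.diam * C.maxWidth G s) t ht
    fun s hs => by
      have hs' := Ico_subset_Icc_self hs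
      refine ⟨?_, mul_le_mul_of_nonneg_left (hM s hs.1) (Nat.cast_nonneg _)⟩
      rw [sub_zero, min_eq_left hs.2.le]
      exact (pi_norm_le_iff_of_nonneg (mul_nonneg (Nat.cast_nonneg _) (hmw s hs.1))).2 (heb s hs')
  have hdiff : ‖X t - AgentFamily.diagMap N m n (s' t, z' t)‖ ≤ ‖x t - x₁ t‖ + ‖x₁ t - x' t‖ := by
    rw [← hxX hright, ← hxX' _ hright]
    exact norm_sub_le_norm_sub_add_norm_sub _ _ _
  have hout : ‖(y t i, z t i) - (s' t, z' t)‖ ≤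
      ‖e t i‖ + ‖X t - AgentFamily.diagMap N m n (s' t, z' t)‖ := by
    rw [Prod.mk_sub_mk, Prod.norm_mk]
    refine max_le ?_ ?_
    · refine (norm_sub_le_norm_sub_add_norm_sub (y t i) (X t).1 (s' t)).trans ?_
      exact add_le_add_right (norm_fst_le (X t - AgentFamily.diagMap N m n (s' t, z' t))) _
    · have h1 := (norm_le_pi_norm (X t - AgentFamily.diagMap N m n (s' t, z' t)).2 i).trans
        (norm_snd_le _)
      have h2 : (X t - AgentFamily.diagMap N m n (s' t, z' t)).2 i = z t i - z' t := by
        rw [hX, AgentFamily.diagMap_apply]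
        rfl
      rw [h2] at h1
      linarith [norm_nonneg (e t i)]
  linarith [heb t hright i]
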